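/- **Theorem (Coverage Guarantee).** Let $\mathcal Z$ be a bounded separable metric space (for instance a bounded subset of $\mathbb R^d$) with distance $d$ and diameter $\mathrm{diam}(\mathcal Z)=\sup_{z,z'}d(z,z')$, and let $\ell:\mathbb R^p\times\mathcal Z\to\mathbb R$ be a loss that is convex in $\theta\in\mathbb R^p$ for each $z$. For a probability measure $Q$ on $\mathcal Z$ write $\hat\theta(Q)=\arg\min_\theta \mathbb E_Q[\ell(\theta,z)]$ and $H_Q=\mathbb E_Q[\nabla^2_\theta\ell(\hat\theta(Q),z)]$. Call $Q$ *well posed* if $\ell(\theta,\cdot)$ is $Q$-integrable for every $\theta$, the minimizer $\hat\theta(Q)$ exists and is unique, and $H_Q$ exists and is positive definite. For well-posed $Q$ the influence of $z$ on $z_{\mathrm{test}}$ when training on $Q$ is $$\mathcal I_Q(z,z_{\mathrm{test}})=-\nabla_\theta\ell(\hat\theta(Q),z_{\mathrm{test}})^\top H_Q^{-1}\,\nabla_\theta\ell(\hat\theta(Q),z).$$ For $n\ge2$, training points $z_1,\dots,z_n\in\mathcal Z$ and an index $i$, let $P_n=\frac1n\sum_{j}\delta_{z_j}$ and $P_{n,-i}=\frac1{n-1}\sum_{j\ne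 i}\delta_{z_j}$. The leave-one-out influence of $z_i$ on $z_{\mathrm{test}}$ is $\mathcal I^{\mathrm{LOO}}_i=\mathcal I_{P_{n,-i}}(z_i,z_{\mathrm{test}})$, and the W-RIF robust interval of radius $\varepsilon$ is $$\mathcal I^{\mathrm{range}}_\varepsilon(z_i,z_{\mathrm{test}})=\Big[\inf_{Q}\mathcal I_Q(z_i,z_{\mathrm{test}}),\ \sup_{Q}\mathcal I_Q(z_i,z_{\mathrm{test}})\Big],$$ where $Q$ runs over the well-posed probability measures with $W_1(Q,P_n)\le\varepsilon$ ($W_1$ the Wasserstein distance of order one; the endpoints are taken in $[-\infty,\infty]$). Let $M,B,\lambda$ be given real numbers. Then there is $\varepsilon_0>0$, depending only on $\mathcal Z$, $p$, $M$, $B$ and $\lambda$, with the following property. Assume that $\mathbb E_{P_n}[\ell(\cdot,z)]$ has a minimizer $\hat\theta=\hat\theta(P_n)$ and that the regularity conditions hold with these constants: 1. $\ell(\cdot,z)$ is twice continuously differentiable for every $z$; 2. $H=\frac1n\sum_j\nabla^2_\theta\ell(\hat\theta,z_j)$ is positive definite, with all eigenvalues at least $\lambda>0$; 3. $M>0$ and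 $\|\nabla_\theta\ell(\theta,z)\|\le M$ for all $\theta,z$; 4. $\nabla^3_\theta\ell(\theta,z)$ exists and $\|\nabla^3_\theta\ell(\theta,z)\|\le B$ for all $\theta,z$. Then for every $z_{\mathrm{test}}\in\mathcal Z$ and every $\varepsilon$ with $\frac{\mathrm{diam}(\mathcal Z)}{n}\le\varepsilon\le\varepsilon_0$, the leave-one-out distribution $P_{n,-i}$ is well posed and $$\mathcal I^{\mathrm{LOO}}_i\in\mathcal I^{\mathrm{range}}_\varepsilon(z_i,z_{\mathrm{test}}).$$ -/

import Mathlib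

open MeasureTheory Set
open scoped ENNReal

noncomputable section

namespace WRIF

/-- The parameter space `ℝ^p` with its Euclidean norm. -/
abbrev Param (p : ℕ) : Type := EuclideanSpace ℝ (Fin p)

section Distributions

variable {Z : Type*} [MetricSpace Z] [MeasurableSpace Z]

/-- `π` is a coupling of `μ` and `ν`. -/
def IsCoupling (π : Measure (Z × Z)) (μ ν : Measure Z) : Prop :=
  π.map Prod.fst = μ ∧ π.map Prod.snd = ν

/-- The Wasserstein distance of order one: the infimum of the transport cost `∫ d(x, y) dπ(x, y)`
over all couplings `π` of `μ` and `ν`. -/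
def W1 (μ ν : Measure Z) : ℝ≥0∞ :=
  ⨅ (π : Measure (Z × Z)) (_ : IsCoupling π μ ν), ∫⁻ q, edist q.1 q.2 ∂π

/-- The empirical distribution `P_n = (1/n) ∑_j δ_{z_j}`. -/
def empirical {n : ℕ} (z : Fin n → Z) : Measure Z :=
  (n : ℝ≥0∞)⁻¹ • ∑ j, Measure.dirac (z j)

/-- The leave-one-out distribution `P_{n,-i} = (1/(n-1)) ∑_{j ≠ i} δ_{z_j}` (used for `n ≥ 2`). -/
def leaveOneOut {n : ℕ} (z : Fin n → Z) (i : Fin n) : Measure Z :=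
  ((n - 1 : ℕ) : ℝ≥0∞)⁻¹ • ∑ j ∈ Finset.univ.erase i, Measure.dirac (z j)

end Distributions

section Influence

variable {Z : Type*} {p : ℕ}

/-- The gradient `∇_θ ℓ(θ, z)`. -/
def grad (ℓ : Param p → Z → ℝ) (θ : Param p) (z : Z) : Param p :=
  gradient (fun θ' => ℓ θ' z) θ

/-- The Hessian `∇²_θ ℓ(θ, z)`, as an operator on `ℝ^p`. -/
def hess (ℓ : Param p → Z → ℝ) (θ : Param p) (z : Z) : Param p →L[ℝ] Param p :=
  fderiv ℝ (fun θ' => grad ℓ θ' z) θ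

/-- The third derivative `∇³_θ ℓ(θ, z)`. -/
def third (ℓ : Param p → Z → ℝ) (θ : Param p) (z : Z) :
    Param p →L[ℝ] Param p →L[ℝ] Param p :=
  fderiv ℝ (fun θ' => hess ℓ θ' z) θ

variable [MeasurableSpace Z]

/-- `θ` minimizes the risk `E_Q[ℓ(·, z)]` over `ℝ^p` (and that risk is defined). -/
def IsMinimizer (ℓ : Param p → Z → ℝ) (Q : Measure Z) (θ : Param p) : Prop :=
  (∀ θ', Integrable (ℓ θ') Q) ∧ ∀ θ', ∫ z, ℓ θ z ∂Q ≤ ∫ z, ℓ θ' z ∂Q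

/-- The trained parameter `θ̂(Q) = argmin_θ E_Q[ℓ(θ, z)]` (only used when a minimizer exists). -/
def thetaHat (ℓ : Param p → Z → ℝ) (Q : Measure Z) : Param p :=
  Classical.epsilon (IsMinimizer ℓ Q)

/-- The Hessian `H_Q = E_Q[∇²_θ ℓ(θ̂(Q), z)]`. -/
def riskHess (ℓ : Param p → Z → ℝ) (Q : Measure Z) : Param p →L[ℝ] Param p :=
  ∫ z, hess ℓ (thetaHat ℓ Q) z ∂Q

/-- Training on `Q` is well posed: the risk has exactly one minimizer, and the Hessian there exists
and is positive definite. These are the `Q` for which the influence `I_Q` is defined. -/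
def WellPosed (ℓ : Param p → Z → ℝ) (Q : Measure Z) : Prop :=
  (∃! θ, IsMinimizer ℓ Q θ) ∧ Integrable (hess ℓ (thetaHat ℓ Q)) Q ∧
    (riskHess ℓ Q).IsSymmetric ∧ ∀ v, v ≠ 0 → 0 < inner ℝ v (riskHess ℓ Q v)

/-- The influence of `zi` on `ztest` when training on `Q`:
`I_Q(zi, ztest) = -∇_θ ℓ(θ̂(Q), ztest)ᵀ H_Q⁻¹ ∇_θ ℓ(θ̂(Q), zi)`. -/
def influence (ℓ : Param p → Z → ℝ) (Q : Measure Z) (zi ztest : Z) : ℝ :=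
  -inner ℝ (grad ℓ (thetaHat ℓ Q) ztest)
    ((riskHess ℓ Q).inverse (grad ℓ (thetaHat ℓ Q) zi))

/-- The regularity conditions at the training distribution `P`, with their constants: `M` bounds
the gradient, `B` bounds the third derivative, and `lam > 0` is a lower bound for the spectrum of
the (positive definite) Hessian of the risk at `θ̂(P)`. -/
structure RegularityConditions (ℓ : Param p → Z → ℝ) (P : Measure Z) (M B lam : ℝ) : Prop where
  contDiff : ∀ z, ContDiff ℝ 2 (fun θ => ℓ θ z)
  hess_posDef : 0 < lam ∧ ∀ v, lam * ‖v‖ ^ 2 ≤ inner ℝ v (riskHess ℓ P v)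
  grad_bound : 0 < M ∧ ∀ θ z, ‖grad ℓ θ z‖ ≤ M
  third_exists : ∀ z, Differentiable ℝ (fun θ => hess ℓ θ z)
  third_bound : ∀ θ z, ‖third ℓ θ z‖ ≤ B

/-- The values `I_Q(zi, ztest)`, where `Q` runs over the probability measures with
`W₁(Q, P) ≤ ε` for which the influence is defined. -/
def influenceValues [MetricSpace Z] (ℓ : Param p → Z → ℝ) (P : Measure Z) (ε : ℝ)
    (zi ztest : Z) : Set EReal :=
  {x | ∃ Q : Measure Z, IsProbabilityMeasure Q ∧ W1 Q P ≤ ENNReal.ofReal ε ∧ WellPosed ℓ Q ∧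
    x = (influence ℓ Q zi ztest : EReal)}

/-- The robust influence interval `[inf_Q I_Q, sup_Q I_Q]` over the Wasserstein ball of radius `ε`
around `P`. The infimum and supremum are taken in the extended reals. -/
def robustInterval [MetricSpace Z] (ℓ : Param p → Z → ℝ) (P : Measure Z) (ε : ℝ)
    (zi ztest : Z) : Set EReal :=
  Icc (sInf (influenceValues ℓ P ε zi ztest)) (sSup (influenceValues ℓ P ε zi ztest))

/-- The leave-one-out influence of the `i`-th training point: its influence on `ztest` when the
model is trained on the leave-one-out distribution. -/
def looInfluence [MetricSpace Z] (ℓ : Param p → Z → ℝ) {n : ℕ} (z : Fin n → Z) (i : Fin n)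
    (ztest : Z) : ℝ :=
  influence ℓ (leaveOneOut z i) (z i) ztest

end Influence

end WRIF

end

/-! The leave-one-out distribution is itself a competitor in the robust interval: moving the mass
1/n of the removed point onto the others costs at most diam/n (`W1_leaveOneOut_empirical_le`). Its
influence therefore lies between the infimum and the supremum once it is well posed, and
well-posedness is the real content.

If diam > 0 and ε₀ = diam/N, then diam/n ≤ ε ≤ ε₀ forces n ≥ N, so n may be assumed large. At the
full minimizer the gradients sum to zero, so deleting one leaves a mean gradient of size at most
M/(n-1). The Hessian is B-Lipschitz in θ and bounded by 2M + B (`norm_hess_le`), so the remaining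
mean Hessian is at least λ/2 on a ball of fixed radius. A convex function with such curvature and a
small enough gradient at the centre has exactly one minimizer (`ConvexOn.exists_unique_minimizer`).
If diam = 0, all points coincide and deletion changes nothing. -/

/-! ### Convex functions with curvature bounded below on a ball -/

section Convex

variable {E : Type*} [NormedAddCommGroup E] [InnerProductSpace ℝ E]

theorem ConvexOn.add_inner_gradient_le [CompleteSpace E] {f : E → ℝ} {g x : E}
    (hf : ConvexOn ℝ univ f) (hg : HasGradientAt f g x) (y : E) :
    f x + inner ℝ g (y - x) ≤ f y := by
  have hconv : ConvexOn ℝ univ (fun t : ℝ => f (AffineMap.lineMap x y t)) :=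
    hf.comp_affineMap (AffineMap.lineMap x y)
  have hderiv : HasDerivAt (fun t : ℝ => f (AffineMap.lineMap x y t)) (inner ℝ g (y - x)) 0 := by
    have h1 : HasFDerivAt f (InnerProductSpace.toDual ℝ E g) (AffineMap.lineMap x y (0 : ℝ)) := by
      simpa using hg.hasFDerivAt
    exact h1.comp_hasDerivAt (0 : ℝ) AffineMap.hasDerivAt_lineMap
  have h := hconv.le_slope_of_hasDerivAt (mem_univ 0) (mem_univ 1) one_pos hderiv
  simp [slope_def_field] at h
  linarith

theorem inner_sub_ge_of_inner_fderiv_ge {s : Set E} (hs : Convex ℝ s) {g : E → E}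
    {H : E → E →L[ℝ] E} (hH : ∀ x, HasFDerivAt g (H x) x) {c : ℝ}
    (hpos : ∀ x ∈ s, ∀ v, c * ‖v‖ ^ 2 ≤ inner ℝ v (H x v)) {x y : E} (hx : x ∈ s) (hy : y ∈ s) :
    c * ‖y - x‖ ^ 2 ≤ inner ℝ (y - x) (g y - g x) := by
  have hderiv (t : ℝ) : HasDerivAt (fun t : ℝ => inner ℝ (y - x) (g (AffineMap.lineMap x y t)))
      (inner ℝ (y - x) (H (AffineMap.lineMap x y t) (y - x))) t := by
    have h1 := (hH (AffineMap.lineMap x y t)).comp_hasDerivAt t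
      (AffineMap.hasDerivAt_lineMap (a := x) (b := y))
    simpa using (hasDerivAt_const t (y - x)).inner ℝ h1
  -- Pairing with y - x makes the function scalar, so the mean value theorem applies.
  obtain ⟨t, ht, h⟩ := exists_hasDerivAt_eq_slope _ _ zero_lt_one
    (fun t _ => (hderiv t).continuousAt.continuousWithinAt) (fun t _ => hderiv t)
  have hmem : AffineMap.lineMap x y t ∈ s :=
    hs.segment_subset hx hy (lineMap_mem_segment ℝ x y (Ioo_subset_Icc_self ht))
  have := hpos _ hmem (y - x)
  rw [h] at this
  simpa [inner_sub_right] using this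

/-- Tangent inequalities from x to the midpoint m and from m to y are added, and strong monotonicity
of the gradient between x and m supplies the gain. This yields c/4 instead of the sharp c/2, but
needs no second-order Taylor expansion. -/
theorem ConvexOn.quadratic_growth [CompleteSpace E] {s : Set E} (hs : Convex ℝ s) {f : E → ℝ}
    {g : E → E} {H : E → E →L[ℝ] E} (hf : ConvexOn ℝ univ f) (hg : ∀ x, HasGradientAt f (g x) x)
    (hH : ∀ x, HasFDerivAt g (H x) x) {c : ℝ}
    (hpos : ∀ x ∈ s, ∀ v, c * ‖v‖ ^ 2 ≤ inner ℝ v (H x v)) {x y : E} (hx : x ∈ s) (hy : y ∈ s) :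
    f x + inner ℝ (g x) (y - x) + c / 4 * ‖y - x‖ ^ 2 ≤ f y := by
  set m : E := midpoint ℝ x y
  have hm : m ∈ s := hs.midpoint_mem hx hy
  have e1 : m - x = (2⁻¹ : ℝ) • (y - x) := by simp [m]
  have e2 : y - m = (2⁻¹ : ℝ) • (y - x) := by simp [m]
  have h1 := add_inner_gradient_le hf (hg x) m
  have h2 := add_inner_gradient_le hf (hg m) y
  have h3 := inner_sub_ge_of_inner_fderiv_ge hs hH hpos hx hm
  rw [e1] at h1 h3
  rw [e2] at h2
  simp only [inner_smul_right, real_inner_smul_left, norm_smul, inner_sub_right _ (g m), mul_pow] at h1 h2 h3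
  rw [real_inner_comm (g m), real_inner_comm (g x)] at h3
  norm_num at h1 h2 h3
  linarith

theorem ConvexOn.exists_unique_minimizer [FiniteDimensional ℝ E] {f : E → ℝ} {g : E → E}
    {H : E → E →L[ℝ] E} (hf : ConvexOn ℝ univ f)
    (hg : ∀ x, HasGradientAt f (g x) x) (hH : ∀ x, HasFDerivAt g (H x) x) {x₀ : E} {r c : ℝ}
    (hr : 0 < r) (hc : 0 < c)
    (hpos : ∀ x ∈ Metric.closedBall x₀ r, ∀ v, c * ‖v‖ ^ 2 ≤ inner ℝ v (H x v))
    (hsmall : ‖g x₀‖ < c / 4 * r) :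
    ∃ x ∈ Metric.closedBall x₀ r, (∀ y, f x ≤ f y) ∧ ∀ y, (∀ w, f y ≤ f w) → y = x := by
  have hs := convex_closedBall x₀ r
  have h0 : x₀ ∈ Metric.closedBall x₀ r := Metric.mem_closedBall_self hr.le
  have hcont : ContinuousOn f (Metric.closedBall x₀ r) :=
    fun x _ => (hg x).continuousAt.continuousWithinAt
  obtain ⟨x, hx, hmin⟩ := (isCompact_closedBall x₀ r).exists_isMinOn ⟨x₀, h0⟩ hcont
  -- On the sphere, growth from the centre gives f x ≥ f x₀ - ‖g x₀‖ r + (c/4) r² > f x₀, so the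
  -- minimum over the ball is interior.
  have hlt : dist x x₀ < r := by
    refine lt_of_le_of_ne hx fun he => ?_
    have h1 := quadratic_growth hs hf hg hH hpos h0 hx
    have h2 := abs_le.1 (abs_real_inner_le_norm (g x₀) (x - x₀))
    have h3 := hmin h0
    simp only [mem_ofPred_eq] at h3
    rw [dist_eq_norm] at he
    rw [he] at h1 h2
    nlinarith [mul_lt_mul_of_pos_right hsmall hr]
  have hloc : IsLocalMin f x := hmin.isLocalMin <|
    Filter.mem_of_superset (Metric.isOpen_ball.mem_nhds (Metric.mem_ball.2 hlt))
      Metric.ball_subset_closedBall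
  have hglob (y : E) : f x ≤ f y := IsMinOn.of_isLocalMin_of_convex_univ hloc hf y
  refine ⟨x, hx, hglob, fun y hy => ?_⟩
  have hgx : g x = 0 := by
    have := hloc.hasFDerivAt_eq_zero (hg x).hasFDerivAt
    simpa using this
  -- A second minimizer y may lie outside the ball, where no curvature is known. A point of the
  -- segment close to x stays inside, and convexity makes it minimal too.
  have hev : ∀ᶠ t : ℝ in nhdsWithin 0 (Ioi 0),
      AffineMap.lineMap x y t ∈ Metric.ball x₀ r ∧ t ∈ Ioo (0 : ℝ) 1 := by
    refine Filter.Eventually.and ?_ (Ioo_mem_nhdsGT one_pos)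
    refine nhdsWithin_le_nhds ?_
    refine (AffineMap.lineMap_continuous (R := ℝ) (p := x) (q := y)).continuousAt.preimage_mem_nhds
      (Metric.isOpen_ball.mem_nhds ?_)
    simpa using hlt
  obtain ⟨t, ht, ht0, ht1⟩ := hev.exists
  have h1 := quadratic_growth hs hf hg hH hpos hx (Metric.ball_subset_closedBall ht)
  have h2 : f (AffineMap.lineMap x y t) ≤ f x := by
    have := hf.2 (mem_univ x) (mem_univ y) (sub_nonneg.2 ht1.le) ht0.le (by ring)
    rw [AffineMap.lineMap_apply_module]
    refine this.trans ?_
    rw [smul_eq_mul, smul_eq_mul]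
    nlinarith [hy x, hglob y]
  rw [hgx, inner_zero_left] at h1
  have h3 : ‖AffineMap.lineMap x y t - x‖ ^ 2 ≤ 0 := by nlinarith
  have h4 : t • (y - x) = 0 := by
    have : ‖AffineMap.lineMap x y t - x‖ = 0 := by
      simpa using le_antisymm h3 (sq_nonneg _)
    simpa [AffineMap.lineMap_apply] using this
  have h5 := (smul_eq_zero.1 h4).resolve_left ht0.ne'
  exact sub_eq_zero.1 h5

end Convex

namespace WRIF

/-! ### Transport cost of leaving one point out -/

section Wasserstein

variable {Z : Type*} [MetricSpace Z] [MeasurableSpace Z]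

omit [MetricSpace Z] in
theorem isProbabilityMeasure_empirical {n : ℕ} (hn : n ≠ 0) (z : Fin n → Z) :
    IsProbabilityMeasure (empirical z) := by
  constructor
  simp [empirical, ENNReal.inv_mul_cancel, hn]

omit [MetricSpace Z] in
theorem isProbabilityMeasure_leaveOneOut {n : ℕ} (hn : 2 ≤ n) (z : Fin n → Z) (i : Fin n) :
    IsProbabilityMeasure (leaveOneOut z i) := by
  constructor
  have h : ((n - 1 : ℕ) : ℝ≥0∞) ≠ 0 := by
    rw [Nat.cast_ne_zero]; omega
  simp only [leaveOneOut, Measure.smul_apply, Measure.finsetSum_apply, measure_univ, smul_eq_mul,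
    Finset.sum_const, Finset.card_erase_of_mem (Finset.mem_univ i), Finset.card_univ,
    Fintype.card_fin, nsmul_eq_mul, mul_one]
  exact ENNReal.inv_mul_cancel h (ENNReal.natCast_ne_top _)

/-- Keep the mass of each remaining point in place and spread the mass of `z i` over them. -/
theorem W1_leaveOneOut_empirical_le [SecondCountableTopology Z] [BoundedSpace Z] [BorelSpace Z]
    {n : ℕ} (hn : 2 ≤ n) (z : Fin n → Z) (i : Fin n) :
    W1 (leaveOneOut z i) (empirical z) ≤
      ENNReal.ofReal (Metric.diam (univ : Set Z) / n) := by
  set a : ℝ≥0∞ := (n : ℝ≥0∞)⁻¹ with ha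
  set b : ℝ≥0∞ := ((n - 1 : ℕ) : ℝ≥0∞)⁻¹ with hb
  have hn0 : (n : ℝ≥0∞) ≠ 0 := by rw [Nat.cast_ne_zero]; omega
  have hn1 : ((n - 1 : ℕ) : ℝ≥0∞) ≠ 0 := by rw [Nat.cast_ne_zero]; omega
  have hcancel : ((n - 1 : ℕ) : ℝ≥0∞) * b = 1 :=
    ENNReal.mul_inv_cancel hn1 (ENNReal.natCast_ne_top _)
  have hcancel' : (n : ℝ≥0∞) * a = 1 := ENNReal.mul_inv_cancel hn0 (ENNReal.natCast_ne_top _)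
  -- 1/n + 1/(n(n-1)) = 1/(n-1): each remaining point keeps its mass and receives an equal share of
  -- the removed mass.
  have hab : a + a * b = b := by
    have h1 : (n : ℝ≥0∞) = ((n - 1 : ℕ) : ℝ≥0∞) + 1 := by
      rw [← Nat.cast_add_one]; congr 1; omega
    calc a + a * b = a * (((n - 1 : ℕ) : ℝ≥0∞) * b) + a * b := by rw [hcancel, mul_one]
      _ = (((n - 1 : ℕ) : ℝ≥0∞) + 1) * a * b := by ring
      _ = b := by rw [← h1, hcancel', one_mul]
  have hcard : (Finset.univ.erase i).card = n - 1 := by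
    rw [Finset.card_erase_of_mem (Finset.mem_univ i), Finset.card_univ, Fintype.card_fin]
  let π : Measure (Z × Z) := a • ∑ j ∈ Finset.univ.erase i, Measure.dirac (z j, z j) +
    (a * b) • ∑ j ∈ Finset.univ.erase i, Measure.dirac (z j, z i)
  have hfst : π.map Prod.fst = leaveOneOut z i := by
    simp only [π, ← Measure.mapₗ_apply_of_measurable measurable_fst, map_add, map_smul, map_sum]
    simp only [Measure.mapₗ_apply_of_measurable measurable_fst, Measure.map_dirac' measurable_fst]
    rw [← add_smul, hab, leaveOneOut]
  have hsnd : π.map Prod.snd = empirical z := by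
    simp only [π, ← Measure.mapₗ_apply_of_measurable measurable_snd, map_add, map_smul, map_sum]
    simp only [Measure.mapₗ_apply_of_measurable measurable_snd, Measure.map_dirac' measurable_snd]
    rw [empirical, ← Finset.sum_erase_add _ _ (Finset.mem_univ i), smul_add, Finset.sum_const,
      hcard, ← Nat.cast_smul_eq_nsmul ℝ≥0∞, smul_smul, mul_assoc, mul_comm b, hcancel, mul_one]
  refine (iInf₂_le π ⟨hfst, hsnd⟩).trans ?_
  have hcost : ∫⁻ q, edist q.1 q.2 ∂π =
      a * b * ∑ j ∈ Finset.univ.erase i, edist (z j) (z i) := by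
    simp [π, lintegral_add_measure, lintegral_smul_measure, lintegral_finsetSum_measure]
  have hdist (j : Fin n) : edist (z j) (z i) ≤ ENNReal.ofReal (Metric.diam (univ : Set Z)) := by
    rw [edist_dist]
    exact ENNReal.ofReal_le_ofReal
      (Metric.dist_le_diam_of_mem (Bornology.IsBounded.all _) (mem_univ _) (mem_univ _))
  rw [hcost]
  calc a * b * ∑ j ∈ Finset.univ.erase i, edist (z j) (z i)
      ≤ a * b * ∑ j ∈ Finset.univ.erase i, ENNReal.ofReal (Metric.diam (univ : Set Z)) := by
        gcongr; exact hdist _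
    _ = a * (((n - 1 : ℕ) : ℝ≥0∞) * b) * ENNReal.ofReal (Metric.diam (univ : Set Z)) := by
        rw [Finset.sum_const, hcard, nsmul_eq_mul]; ring
    _ = ENNReal.ofReal (Metric.diam (univ : Set Z) / n) := by
        rw [hcancel, mul_one, ENNReal.ofReal_div_of_pos (by positivity), ENNReal.ofReal_natCast,
          div_eq_mul_inv, mul_comm]

end Wasserstein

/-! ### Derivative bounds for a single loss -/

section Loss

variable {Z : Type*} {p : ℕ} {ℓ : Param p → Z → ℝ} {z : Z}

theorem hasGradientAt_grad (hℓ : ContDiff ℝ 2 (fun θ => ℓ θ z)) (θ : Param p) :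
    HasGradientAt (fun θ => ℓ θ z) (grad ℓ θ z) θ :=
  ((hℓ.differentiable (by norm_num)) θ).hasGradientAt

theorem hasFDerivAt_grad (hℓ : ContDiff ℝ 2 (fun θ => ℓ θ z)) (θ : Param p) :
    HasFDerivAt (fun θ => grad ℓ θ z) (hess ℓ θ z) θ := by
  have h : Differentiable ℝ (fderiv ℝ (fun θ => ℓ θ z)) :=
    (hℓ.fderiv_right (m := 1) (by norm_num)).differentiable (by norm_num)
  exact ((InnerProductSpace.toDual ℝ (Param p)).symm.differentiable.comp h θ).hasFDerivAt

theorem isSymmetric_hess (hℓ : ContDiff ℝ 2 (fun θ => ℓ θ z)) (θ : Param p) :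
    (hess ℓ θ z).IsSymmetric := by
  have hsymm : IsSymmSndFDerivAt ℝ (fun θ => ℓ θ z) θ :=
    hℓ.contDiffAt.isSymmSndFDerivAt (by simp)
  have hderiv : HasFDerivAt (fderiv ℝ (fun θ => ℓ θ z))
      ((InnerProductSpace.toDual ℝ (Param p)).toContinuousLinearEquiv.toContinuousLinearMap.comp
        (hess ℓ θ z)) θ := by
    have h := (InnerProductSpace.toDual ℝ
      (Param p)).toContinuousLinearEquiv.toContinuousLinearMap.hasFDerivAt.comp θ
        (hasFDerivAt_grad hℓ θ)
    refine h.congr_of_eventuallyEq (.of_forall fun x => ?_)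
    exact (toDual_gradient (𝕜 := ℝ) (f := fun θ => ℓ θ z) (x := x)).symm
  intro v w
  have h := hsymm v w
  rw [hderiv.fderiv] at h
  have h' : inner ℝ (hess ℓ θ z v) w = inner ℝ (hess ℓ θ z w) v := h
  exact h'.trans (real_inner_comm _ _)

theorem norm_hess_sub_le {B : ℝ} (hd : Differentiable ℝ (fun θ => hess ℓ θ z))
    (hB : ∀ θ, ‖third ℓ θ z‖ ≤ B) (θ θ' : Param p) :
    ‖hess ℓ θ' z - hess ℓ θ z‖ ≤ B * ‖θ' - θ‖ :=
  convex_univ.norm_image_sub_le_of_norm_fderiv_le (fun x _ => hd x) (fun x _ => hB x)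
    (mem_univ θ) (mem_univ θ')

/-- A bounded gradient and a bounded third derivative bound the Hessian. -/
theorem norm_hess_le {M B : ℝ} (hℓ : ContDiff ℝ 2 (fun θ => ℓ θ z))
    (hM : ∀ θ, ‖grad ℓ θ z‖ ≤ M) (hd : Differentiable ℝ (fun θ => hess ℓ θ z))
    (hB : ∀ θ, ‖third ℓ θ z‖ ≤ B) (θ : Param p) : ‖hess ℓ θ z‖ ≤ 2 * M + B := by
  have hM0 : 0 ≤ M := (norm_nonneg _).trans (hM θ)
  have hB0 : 0 ≤ B := (norm_nonneg (third ℓ θ z)).trans (hB θ)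
  refine ContinuousLinearMap.opNorm_le_of_unit_norm (by positivity) fun v hv => ?_
  -- Over a unit step v, the gradient changes by at most 2M and differs from its linearization by at
  -- most B.
  have h := (convex_closedBall θ 1).norm_image_sub_le_of_norm_hasFDerivWithin_le'
    (f := fun θ => grad ℓ θ z) (f' := fun θ => hess ℓ θ z) (φ := hess ℓ θ z) (C := B)
    (x := θ) (y := θ + v)
    (fun x _ => (hasFDerivAt_grad hℓ x).hasFDerivWithinAt)
    (fun x hx => (norm_hess_sub_le hd hB θ x).trans
      (mul_le_of_le_one_right hB0 (by simpa [dist_eq_norm] using hx)))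
    (by simp) (by simp [hv])
  simp only [add_sub_cancel_left, hv, mul_one] at h
  have h1 := norm_sub_le (grad ℓ (θ + v) z - grad ℓ θ z)
    (grad ℓ (θ + v) z - grad ℓ θ z - hess ℓ θ z v)
  rw [sub_sub_cancel] at h1
  have h2 := norm_sub_le (grad ℓ (θ + v) z) (grad ℓ θ z)
  linarith [hM (θ + v), hM θ]

end Loss

/-! ### Risks of finitely supported distributions -/

section FiniteSupport

variable {Z : Type*} [MeasurableSpace Z] [MeasurableSingletonClass Z] {ι : Type*}
  {E : Type*} [NormedAddCommGroup E]

/-- Point masses integrate every function, so the loss need not be measurable in z; `m ≠ 0` keeps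
the weight finite. -/
theorem integrable_smul_sum_dirac {m : ℕ} (hm : m ≠ 0) (s : Finset ι) (z : ι → Z) (f : Z → E) :
    Integrable f ((m : ℝ≥0∞)⁻¹ • ∑ j ∈ s, Measure.dirac (z j)) := by
  refine Integrable.smul_measure ?_ (by simp [hm])
  rw [integrable_finsetSum_measure]
  exact fun j _ => integrable_dirac enorm_lt_top

theorem integral_smul_sum_dirac [NormedSpace ℝ E] [CompleteSpace E] (m : ℕ) (s : Finset ι)
    (z : ι → Z) (f : Z → E) :
    ∫ x, f x ∂((m : ℝ≥0∞)⁻¹ • ∑ j ∈ s, Measure.dirac (z j)) = (m : ℝ)⁻¹ • ∑ j ∈ s, f (z j) := by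
  rw [integral_smul_measure, integral_finsetSum_measure fun j _ => integrable_dirac enorm_lt_top]
  simp [integral_dirac]

variable {p : ℕ} {ℓ : Param p → Z → ℝ}

theorem hasGradientAt_risk (m : ℕ) (s : Finset ι) (z : ι → Z)
    (hℓ : ∀ z', ContDiff ℝ 2 (fun θ => ℓ θ z')) (θ : Param p) :
    HasGradientAt (fun θ => ∫ x, ℓ θ x ∂((m : ℝ≥0∞)⁻¹ • ∑ j ∈ s, Measure.dirac (z j)))
      ((m : ℝ)⁻¹ • ∑ j ∈ s, grad ℓ θ (z j)) θ := by
  simp only [integral_smul_sum_dirac, smul_eq_mul]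
  rw [hasGradientAt_iff_hasFDerivAt, map_smul, map_sum]
  exact (HasFDerivAt.fun_sum fun j _ =>
    (hasGradientAt_grad (hℓ (z j)) θ).hasFDerivAt).const_mul _

/-- Training on a finitely supported distribution is well posed if, near some point, the Hessian of
the risk is bounded below and the gradient of the risk at that point is small. -/
theorem wellPosed_smul_sum_dirac {m : ℕ} (hm : m ≠ 0) (s : Finset ι) (z : ι → Z)
    (hconv : ∀ z', ConvexOn ℝ univ (fun θ => ℓ θ z')) (hℓ : ∀ z', ContDiff ℝ 2 (fun θ => ℓ θ z'))
    {θ₀ : Param p} {r c : ℝ} (hr : 0 < r) (hc : 0 < c)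
    (hpos : ∀ θ ∈ Metric.closedBall θ₀ r, ∀ v,
      c * ‖v‖ ^ 2 ≤ inner ℝ v (((m : ℝ)⁻¹ • ∑ j ∈ s, hess ℓ θ (z j)) v))
    (hsmall : ‖(m : ℝ)⁻¹ • ∑ j ∈ s, grad ℓ θ₀ (z j)‖ < c / 4 * r) :
    WellPosed ℓ ((m : ℝ≥0∞)⁻¹ • ∑ j ∈ s, Measure.dirac (z j)) := by
  set Q : Measure Z := (m : ℝ≥0∞)⁻¹ • ∑ j ∈ s, Measure.dirac (z j)
  have hrisk (θ : Param p) : ∫ x, ℓ θ x ∂Q = (m : ℝ)⁻¹ * ∑ j ∈ s, ℓ θ (z j) :=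
    integral_smul_sum_dirac m s z (ℓ θ)
  have hconvF : ConvexOn ℝ univ (fun θ => ∫ x, ℓ θ x ∂Q) := by
    simp only [hrisk]
    refine ConvexOn.smul (by positivity) ?_
    refine ⟨convex_univ, fun x _ y _ a b ha hb hab => ?_⟩
    simp only [smul_eq_mul, Finset.mul_sum, ← Finset.sum_add_distrib]
    exact Finset.sum_le_sum fun j _ => (hconv (z j)).2 (mem_univ x) (mem_univ y) ha hb hab
  have hgrad (θ : Param p) : HasGradientAt (fun θ => ∫ x, ℓ θ x ∂Q)
      ((m : ℝ)⁻¹ • ∑ j ∈ s, grad ℓ θ (z j)) θ := hasGradientAt_risk m s z hℓ θ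
  have hhess (θ : Param p) : HasFDerivAt (fun θ => (m : ℝ)⁻¹ • ∑ j ∈ s, grad ℓ θ (z j))
      ((m : ℝ)⁻¹ • ∑ j ∈ s, hess ℓ θ (z j)) θ :=
    (HasFDerivAt.fun_sum fun j _ => hasFDerivAt_grad (hℓ (z j)) θ).fun_const_smul _
  have hint (θ : Param p) : Integrable (ℓ θ) Q := integrable_smul_sum_dirac hm s z (ℓ θ)
  obtain ⟨θ₁, hmem, hmin, huniq⟩ :=
    hconvF.exists_unique_minimizer hgrad hhess hr hc hpos hsmall
  have hex : ∃! θ, IsMinimizer ℓ Q θ := ⟨θ₁, ⟨hint, hmin⟩, fun θ hθ => huniq θ hθ.2⟩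
  have hhat : thetaHat ℓ Q = θ₁ := huniq _ (Classical.epsilon_spec hex.exists).2
  have hH : riskHess ℓ Q = (m : ℝ)⁻¹ • ∑ j ∈ s, hess ℓ θ₁ (z j) := by
    rw [riskHess, hhat, integral_smul_sum_dirac]
  refine ⟨hex, integrable_smul_sum_dirac hm s z _, ?_, fun v hv => ?_⟩
  · rw [hH]
    intro v w
    simp only [ContinuousLinearMap.coe_coe, smul_apply,
      sum_apply, real_inner_smul_left, real_inner_smul_right, sum_inner,
      inner_sum]
    congr 1
    exact Finset.sum_congr rfl fun j _ => isSymmetric_hess (hℓ (z j)) θ₁ v w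
  · rw [hH]
    have : 0 < ‖v‖ := norm_pos_iff.2 hv
    exact (by positivity : 0 < c * ‖v‖ ^ 2).trans_le (hpos θ₁ hmem v)

end FiniteSupport

/-! ### Well-posedness after deleting one point -/

section LeaveOneOut

variable {Z : Type*} [MeasurableSpace Z] [MeasurableSingletonClass Z] {p : ℕ}
  {ℓ : Param p → Z → ℝ} {n : ℕ} {z : Fin n → Z}

omit [MeasurableSingletonClass Z] in
theorem RegularityConditions.bound_nonneg {P : Measure Z} {M B lam : ℝ}
    (h : RegularityConditions ℓ P M B lam) (z' : Z) : 0 ≤ B :=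
  (norm_nonneg (third ℓ 0 z')).trans (h.third_bound 0 z')

theorem sum_grad_thetaHat_eq_zero (hℓ : ∀ z', ContDiff ℝ 2 (fun θ => ℓ θ z')) (hn : n ≠ 0)
    (hex : ∃ θ, IsMinimizer ℓ (empirical z) θ) :
    ∑ j, grad ℓ (thetaHat ℓ (empirical z)) (z j) = 0 := by
  have hmin : IsMinimizer ℓ (empirical z) (thetaHat ℓ (empirical z)) :=
    Classical.epsilon_spec hex
  have hg := hasGradientAt_risk n Finset.univ z hℓ (thetaHat ℓ (empirical z))
  have hloc : IsLocalMin (fun θ => ∫ x, ℓ θ x ∂(empirical z)) (thetaHat ℓ (empirical z)) :=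
    .of_forall hmin.2
  have h := hloc.hasFDerivAt_eq_zero hg.hasFDerivAt
  rw [LinearIsometryEquiv.map_eq_zero_iff, smul_eq_zero] at h
  exact h.resolve_left (by simp [hn])

/-- The Hessian of the empirical risk stays bounded below in a neighbourhood of the minimizer. -/
theorem RegularityConditions.le_inner_sum_hess {M B lam : ℝ} (hn : n ≠ 0)
    (h : RegularityConditions ℓ (empirical z) M B lam) {r : ℝ} {θ : Param p}
    (hθ : θ ∈ Metric.closedBall (thetaHat ℓ (empirical z)) r) (v : Param p) :
    n * ((lam - B * r) * ‖v‖ ^ 2) ≤ inner ℝ v ((∑ j, hess ℓ θ (z j)) v) := by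
  set θ₀ := thetaHat ℓ (empirical z)
  have hn' : (0 : ℝ) < n := by positivity
  have h0 : n * (lam * ‖v‖ ^ 2) ≤ inner ℝ v ((∑ j, hess ℓ θ₀ (z j)) v) := by
    have h1 := h.hess_posDef.2 v
    have h2 : riskHess ℓ (empirical z) = (n : ℝ)⁻¹ • ∑ j, hess ℓ θ₀ (z j) :=
      integral_smul_sum_dirac n Finset.univ z (hess ℓ θ₀)
    rw [h2, smul_apply, real_inner_smul_right, le_inv_mul_iff₀ hn'] at h1
    exact h1
  have hj (j : Fin n) :
      inner ℝ v (hess ℓ θ₀ (z j) v) - B * r * ‖v‖ ^ 2 ≤ inner ℝ v (hess ℓ θ (z j) v) := by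
    have hB := h.bound_nonneg (z j)
    have hop : ‖hess ℓ θ₀ (z j) - hess ℓ θ (z j)‖ ≤ B * r := by
      refine (norm_hess_sub_le (h.third_exists _) (fun θ => h.third_bound θ _) θ θ₀).trans ?_
      gcongr
      rwa [← dist_eq_norm, dist_comm]
    have h1 : inner ℝ v ((hess ℓ θ₀ (z j) - hess ℓ θ (z j)) v) ≤ B * r * ‖v‖ ^ 2 := by
      calc _ ≤ ‖v‖ * ‖(hess ℓ θ₀ (z j) - hess ℓ θ (z j)) v‖ := real_inner_le_norm _ _
        _ ≤ ‖v‖ * (B * r * ‖v‖) := by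
          gcongr
          exact (ContinuousLinearMap.le_opNorm _ _).trans (by gcongr)
        _ = B * r * ‖v‖ ^ 2 := by ring
    rw [sub_apply, inner_sub_right] at h1
    linarith
  have hsum := Finset.sum_le_sum fun j (_ : j ∈ Finset.univ) => hj j
  rw [Finset.sum_sub_distrib, ← inner_sum, ← inner_sum, ← sum_apply,
    ← sum_apply, Finset.sum_const, Finset.card_univ, Fintype.card_fin,
    nsmul_eq_mul] at hsum
  linarith

/-- When the diameter is zero, the condition on ε gives no lower bound on n; here deletion leaves
the mean gradient and Hessian unchanged, so n ≥ 2 suffices. -/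
theorem wellPosed_leaveOneOut_of_subsingleton [Subsingleton Z] {M B lam : ℝ} (hn : 2 ≤ n)
    (hconv : ∀ z', ConvexOn ℝ univ (fun θ => ℓ θ z'))
    (hex : ∃ θ, IsMinimizer ℓ (empirical z) θ)
    (h : RegularityConditions ℓ (empirical z) M B lam) (i : Fin n) :
    WellPosed ℓ (leaveOneOut z i) := by
  have hB := h.bound_nonneg (z i)
  have hlam := h.hess_posDef.1
  have hn0 : (n : ℝ) ≠ 0 := by positivity
  have hn1 : ((n - 1 : ℕ) : ℝ) ≠ 0 := by rw [Nat.cast_ne_zero]; omega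
  have hz (j : Fin n) : z j = z i := Subsingleton.elim _ _
  have hBr : B * (lam / (4 * (B + 1))) ≤ lam / 4 := by
    rw [mul_div_assoc', div_le_div_iff₀ (by positivity) (by norm_num)]
    nlinarith
  refine wellPosed_smul_sum_dirac (by omega) _ z hconv h.contDiff
    (θ₀ := thetaHat ℓ (empirical z)) (r := lam / (4 * (B + 1))) (c := lam / 2)
    (by positivity) (by positivity) (fun θ hθ v => ?_) ?_
  · have h1 := h.le_inner_sum_hess (by omega) hθ v
    simp only [hz, Finset.sum_const, Finset.card_erase_of_mem (Finset.mem_univ i),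
      Finset.card_univ, Fintype.card_fin, ← Nat.cast_smul_eq_nsmul ℝ, smul_smul,
      inv_mul_cancel₀ hn1, one_smul] at h1 ⊢
    rw [smul_apply, real_inner_smul_right] at h1
    have h2 := le_of_mul_le_mul_left h1 (by positivity)
    nlinarith [sq_nonneg ‖v‖]
  · have h1 := sum_grad_thetaHat_eq_zero h.contDiff (by omega) hex
    simp only [hz, Finset.sum_const, ← Nat.cast_smul_eq_nsmul ℝ, Finset.card_univ,
      Fintype.card_fin, smul_eq_zero, hn0, false_or] at h1
    simp only [hz, Finset.sum_const, h1, smul_zero, norm_zero]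
    positivity

/-- The sample size from which on leaving out one training point keeps training well posed. -/
noncomputable def sampleThreshold (M B lam : ℝ) : ℕ :=
  ⌈4 * (2 * M + B) / lam⌉₊ + ⌈8 * M / lam / (lam / (4 * (B + 1)))⌉₊ + 2

theorem wellPosed_leaveOneOut {M B lam : ℝ} (hn : sampleThreshold M B lam ≤ n)
    (hconv : ∀ z', ConvexOn ℝ univ (fun θ => ℓ θ z'))
    (hex : ∃ θ, IsMinimizer ℓ (empirical z) θ)
    (h : RegularityConditions ℓ (empirical z) M B lam) (i : Fin n) :
    WellPosed ℓ (leaveOneOut z i) := by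
  have hB := h.bound_nonneg (z i)
  have hlam := h.hess_posDef.1
  have hM := h.grad_bound.1
  have hn2 : 2 ≤ n := le_trans (by simp [sampleThreshold]) hn
  have hcast : ((n - 1 : ℕ) : ℝ) = n - 1 := by rw [Nat.cast_sub (by omega)]; simp
  have hn1 : (0 : ℝ) < (n - 1 : ℕ) := by rw [Nat.cast_pos]; omega
  -- The radius keeps the loss of curvature across the ball below λ/4; B + 1 avoids dividing by zero
  -- when B = 0.
  have hBr : B * (lam / (4 * (B + 1))) ≤ lam / 4 := by
    rw [mul_div_assoc', div_le_div_iff₀ (by positivity) (by norm_num)]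
    nlinarith
  have hN : (⌈4 * (2 * M + B) / lam⌉₊ : ℝ) +
      ⌈8 * M / lam / (lam / (4 * (B + 1)))⌉₊ + 2 ≤ n := by
    exact_mod_cast hn
  set r := lam / (4 * (B + 1))
  have hr : 0 < r := by positivity
  -- The deleted Hessian then costs at most nλ/4 of the summed curvature.
  have hK : 4 * (2 * M + B) ≤ n * lam := by
    have h1 := Nat.le_ceil (4 * (2 * M + B) / lam)
    rw [← div_le_iff₀ hlam]
    have : (0 : ℝ) ≤ ⌈8 * M / lam / r⌉₊ := Nat.cast_nonneg _
    linarith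
  -- This is M/(n-1) < (c/4) r with c = λ/2; the summand 2 in the threshold makes it strict.
  have hG : M < (n - 1 : ℕ) * (lam / 2 / 4 * r) := by
    have h1 := Nat.le_ceil (8 * M / lam / r)
    have : (0 : ℝ) ≤ ⌈4 * (2 * M + B) / lam⌉₊ := Nat.cast_nonneg _
    have h2 : 8 * M / lam / r < (n - 1 : ℕ) := by linarith
    rw [div_lt_iff₀ hr, div_lt_iff₀ hlam] at h2
    linarith
  refine wellPosed_smul_sum_dirac (by omega) _ z hconv h.contDiff
    (θ₀ := thetaHat ℓ (empirical z)) (r := r) (c := lam / 2) hr (by positivity)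
    (fun θ hθ v => ?_) ?_
  · have h1 := h.le_inner_sum_hess (by omega) hθ v
    have h2 : inner ℝ v (hess ℓ θ (z i) v) ≤ (2 * M + B) * ‖v‖ ^ 2 := by
      calc _ ≤ ‖v‖ * ‖hess ℓ θ (z i) v‖ := real_inner_le_norm _ _
        _ ≤ ‖v‖ * ((2 * M + B) * ‖v‖) := by
          gcongr
          exact ContinuousLinearMap.le_of_opNorm_le _ (norm_hess_le (h.contDiff _)
            (fun θ => h.grad_bound.2 θ _) (h.third_exists _) (fun θ => h.third_bound θ _) θ) v
        _ = (2 * M + B) * ‖v‖ ^ 2 := by ring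
    rw [← Finset.sum_erase_add _ _ (Finset.mem_univ i), add_apply,
      inner_add_right] at h1
    rw [smul_apply, real_inner_smul_right, le_inv_mul_iff₀ hn1, hcast]
    have hn0 : (0 : ℝ) ≤ n := Nat.cast_nonneg _
    have h3 : (n : ℝ) * (B * r) ≤ n * (lam / 4) := by gcongr
    -- Of nλ, at most nλ/4 is lost to moving θ and nλ/4 to the deleted point, leaving nλ/2.
    have h4 : ((n : ℝ) - 1) * (lam / 2) ≤ n * (lam - B * r) - (2 * M + B) := by linarith
    have h5 := mul_le_mul_of_nonneg_right h4 (sq_nonneg ‖v‖)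
    linarith
  · have h1 := sum_grad_thetaHat_eq_zero h.contDiff (by omega) hex
    -- The remaining gradients sum to minus the deleted one, of norm at most M.
    rw [← Finset.sum_erase_add _ _ (Finset.mem_univ i), ← eq_neg_iff_add_eq_zero] at h1
    rw [h1, norm_smul, norm_neg, norm_inv, Real.norm_natCast, inv_mul_lt_iff₀ hn1]
    exact (h.grad_bound.2 _ _).trans_lt hG

end LeaveOneOut

end WRIF

/-! ### The coverage guarantee -/

theorem mainTheorem3 {Z : Type*} [MetricSpace Z] [SecondCountableTopology Z] [BoundedSpace Z]
    [MeasurableSpace Z] [BorelSpace Z] (p : ℕ) (M B lam : ℝ) :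
    ∃ ε₀ : ℝ, 0 < ε₀ ∧
      ∀ (ℓ : WRIF.Param p → Z → ℝ) (n : ℕ) (z : Fin n → Z) (i : Fin n) (ztest : Z) (ε : ℝ),
        2 ≤ n →
        (∀ z', ConvexOn ℝ univ (fun θ => ℓ θ z')) →
        (∃ θ, WRIF.IsMinimizer ℓ (WRIF.empirical z) θ) →
        WRIF.RegularityConditions ℓ (WRIF.empirical z) M B lam →
        Metric.diam (univ : Set Z) / n ≤ ε → ε ≤ ε₀ →
        WRIF.WellPosed ℓ (WRIF.leaveOneOut z i) ∧
          (WRIF.looInfluence ℓ z i ztest : EReal) ∈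
            WRIF.robustInterval ℓ (WRIF.empirical z) ε (z i) ztest := by
  have key (ℓ : WRIF.Param p → Z → ℝ) (n : ℕ) (z : Fin n → Z) (i : Fin n) (ztest : Z) (ε : ℝ)
      (hn : 2 ≤ n) (hε : Metric.diam (univ : Set Z) / n ≤ ε)
      (hwell : WRIF.WellPosed ℓ (WRIF.leaveOneOut z i)) :
      (WRIF.looInfluence ℓ z i ztest : EReal) ∈
        WRIF.robustInterval ℓ (WRIF.empirical z) ε (z i) ztest := by
    have hmem : (WRIF.looInfluence ℓ z i ztest : EReal) ∈
        WRIF.influenceValues ℓ (WRIF.empirical z) ε (z i) ztest :=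
      ⟨WRIF.leaveOneOut z i, WRIF.isProbabilityMeasure_leaveOneOut hn z i,
        (WRIF.W1_leaveOneOut_empirical_le hn z i).trans (ENNReal.ofReal_le_ofReal hε), hwell, rfl⟩
    exact ⟨sInf_le hmem, le_sSup hmem⟩
  rcases Metric.diam_nonneg (s := (univ : Set Z)).eq_or_lt with hd | hd
  · have : Subsingleton Z := ⟨fun x y => by
      have := Metric.dist_le_diam_of_mem (Bornology.IsBounded.all univ) (mem_univ x) (mem_univ y)
      exact dist_le_zero.1 (this.trans hd.ge)⟩
    refine ⟨1, one_pos, fun ℓ n z i ztest ε hn hconv hex hreg hε _ => ?_⟩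
    have hwell := WRIF.wellPosed_leaveOneOut_of_subsingleton hn hconv hex hreg i
    exact ⟨hwell, key ℓ n z i ztest ε hn hε hwell⟩
  -- ε₀ is fixed before the regularity conditions are assumed, so the threshold must be positive for
  -- arbitrary real M, B and λ.
  · have hN : (0 : ℝ) < WRIF.sampleThreshold M B lam := by
      rw [Nat.cast_pos]; simp [WRIF.sampleThreshold]
    refine ⟨Metric.diam (univ : Set Z) / WRIF.sampleThreshold M B lam, by positivity,
      fun ℓ n z i ztest ε hn hconv hex hreg hε hε₀ => ?_⟩
    have hle : WRIF.sampleThreshold M B lam ≤ n := by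
      have h1 := (div_le_div_iff_of_pos_left hd (by positivity) hN).1 (hε.trans hε₀)
      exact_mod_cast h1
    have hwell := WRIF.wellPosed_leaveOneOut hle hconv hex hreg i
    exact ⟨hwell, key ℓ n z i ztest ε hn hε hwell⟩
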